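/- Let $D=\{k/2^n : k,n\in\mathbb N\}$ be the set of non-negative dyadic numbers and let $(\Omega,\mathcal A,\mathbb P)$ be a probability space. A real process $B=(B(r))_{r\in D}$ is called a Brownian motion on $D$ if $B(0)=0$ a.s., $B(r)\sim\mathcal N(0,r)$ for $r\in D$, $B$ has independent increments, and $B(s)-B(r)$ has the same law as $B(s-r)$ for all $r\le s$ in $D$. (A) Let $(X_r)_{r\in D}$ be independent $\mathcal N(0,1)$ random variables on $\Omega$, and define $B$ on $D$ by $B(0)=0$, $B(k)=X_1+\dots+X_k$ for integers $k\ge 1$, and, for all $\ell,n\in\mathbb N$, $$B\Big(\frac{2\ell+1}{2^{n+1}}\Big)=\frac{B(\ell/2^n)+B((\ell+1)/2^n)}{2}+\frac{X_{(2\ell+1)/2^{n+1}}}{\sqrt{2^{n+2}}}.$$ Then $B$ is a Brownian motion on $D$. (B) Let $B$ be any Brownian motion on $D$ (for instance the process in (A)). For $k,n\in\mathbb N$ put $$M_{k,n}=\sup_{r\in D\cap[k/2^n,(k+2)/2^n]}\Big|B(r)-B\Big(\frac{k}{2^n}\Big)\Big|\in[0,\infty],\qquad M_n=\max_{0\le k\le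 (n+1)2^n}M_{k,n},$$ and let $N$ be the event that $M_n>1/n$ for infinitely many $n\geq 1$. Then: 1. $\mathbb P(N)=0$. 2. For every $\omega\notin N$: the map $r\mapsto B(r,\omega)$ is uniformly continuous on $D\cap[0,t]$ for every $t\ge 0$; the limit $\tilde B(t,\omega)=\lim_{D\ni r\downarrow t}B(r,\omega)$ (over $r\in D$, $r>t$) exists in $\mathbb R$ for every $t\ge0$; $\tilde B(r,\omega)=B(r,\omega)$ for every $r\in D$; and $t\mapsto\tilde B(t,\omega)$ is continuous on $[0,\infty)$. 3. Let $\tilde B(t,\omega)$ be a fixed real constant wherever the limit does not exist. Then $\tilde B=(\tilde B(t))_{t\ge0}$ has the same finite-dimensional laws as $B$ at times in $D$, and it is a standard Brownian motion: for all $t_1,\dots,t_k\ge 0$ the vector $(\tilde B(t_1),\dots,\tilde B(t_k))$ is centered Gaussian with covariances $\min(t_i,t_j)$, and almost every path of $\tilde B$ is continuous. -/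

import Mathlib

open MeasureTheory ProbabilityTheory Filter Topology
open scoped NNReal ENNReal

/-- The set `D = {k / 2 ^ n : k, n ∈ ℕ}` of non-negative dyadic numbers. -/
def dyadics : Set ℝ≥0 := {r | ∃ k n : ℕ, r = (k : ℝ≥0) / 2 ^ n}

/-- The dyadic number `k / 2 ^ n`, as an element of `D`. -/
noncomputable def dyad (k n : ℕ) : dyadics := ⟨(k : ℝ≥0) / 2 ^ n, k, n, rfl⟩

section Construction

variable {Ω : Type*}

/-- `levelValue X n k` is the value at time `k / 2 ^ n` of the process built from the family `X`,
by recursion on the level `n`: partial sums at integer times, then at each new midpoint the average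
of the two neighbouring values plus an independent term of standard deviation
`1 / √(2 ^ (n + 2))`. -/
noncomputable def levelValue (X : dyadics → Ω → ℝ) : ℕ → ℕ → Ω → ℝ
  | 0, k => fun ω => ∑ j ∈ Finset.range k, X (dyad (j + 1) 0) ω
  | n + 1, m => fun ω =>
      if Even m then levelValue X n (m / 2) ω
      else (levelValue X n (m / 2) ω + levelValue X n (m / 2 + 1) ω) / 2
        + X (dyad m (n + 1)) ω / √(2 ^ (n + 2))

/-- The process `B = (B(r))_{r ∈ D}` built from the family `X = (X_r)_{r ∈ D}`. The value does not
depend on the representation `r = k / 2 ^ n`, see `midpointProcess_dyad`. -/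
noncomputable def midpointProcess (X : dyadics → Ω → ℝ) (r : dyadics) : Ω → ℝ :=
  levelValue X r.2.choose_spec.choose r.2.choose

theorem levelValue_double (X : dyadics → Ω → ℝ) (n k : ℕ) :
    levelValue X (n + 1) (2 * k) = levelValue X n k := by
  funext ω
  simp [levelValue]

theorem levelValue_shift (X : dyadics → Ω → ℝ) (n k j : ℕ) :
    levelValue X (n + j) (k * 2 ^ j) = levelValue X n k := by
  induction j with
  | zero => simp
  | succ j ih =>
    have h : k * 2 ^ (j + 1) = 2 * (k * 2 ^ j) := by ring
    rw [h, ← add_assoc, levelValue_double, ih]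

theorem midpointProcess_dyad (X : dyadics → Ω → ℝ) (k n : ℕ) :
    midpointProcess X (dyad k n) = levelValue X n k := by
  have h := (dyad k n).2.choose_spec.choose_spec
  unfold midpointProcess
  generalize (dyad k n).2.choose_spec.choose = m at h ⊢
  generalize (dyad k n).2.choose = l at h ⊢
  have h' : (k : ℝ≥0) / 2 ^ n = (l : ℝ≥0) / 2 ^ m := h
  rw [div_eq_div_iff (by positivity) (by positivity)] at h'
  have h2 : k * 2 ^ m = l * 2 ^ n := by exact_mod_cast h'
  rw [← levelValue_shift X m l n, ← levelValue_shift X n k m, h2, add_comm]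

/-- Initial condition and partial sums at integer times. -/
theorem midpointProcess_nat (X : dyadics → Ω → ℝ) (k : ℕ) (ω : Ω) :
    midpointProcess X (dyad k 0) ω = ∑ j ∈ Finset.range k, X (dyad (j + 1) 0) ω := by
  rw [midpointProcess_dyad, levelValue]

/-- The midpoint recursion. -/
theorem midpointProcess_mid (X : dyadics → Ω → ℝ) (l n : ℕ) (ω : Ω) :
    midpointProcess X (dyad (2 * l + 1) (n + 1)) ω
      = (midpointProcess X (dyad l n) ω + midpointProcess X (dyad (l + 1) n) ω) / 2
        + X (dyad (2 * l + 1) (n + 1)) ω / √(2 ^ (n + 2)) := by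
  have h : (2 * l + 1) / 2 = l := by omega
  simp only [midpointProcess_dyad]
  rw [levelValue]
  simp [h]

end Construction

section Processes

variable {Ω : Type*} [MeasurableSpace Ω]

/-- `B` is a Brownian motion on the time set `D` of non-negative dyadic numbers (no regularity of
the paths is required). -/
structure IsDyadicBrownian (B : dyadics → Ω → ℝ) (P : Measure Ω) : Prop where
  initial : ∀ᵐ ω ∂P, B (dyad 0 0) ω = 0
  marginal : ∀ r : dyadics, HasLaw (B r) (gaussianReal 0 (r : ℝ≥0)) P
  indep : HasIndepIncrements B P
  stationary : ∀ r h s : dyadics, (s : ℝ≥0) = r + h →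
    IdentDistrib (fun ω => B s ω - B r ω) (B h) P P

end Processes

section Paths

variable {Ω : Type*}

/-- `M_{k,n}`: the supremum of `|B(r) - B(k / 2 ^ n)|` over the dyadic
`r ∈ [k / 2 ^ n, (k + 2) / 2 ^ n]`, as an element of `[0, ∞]`. -/
noncomputable def localOsc (B : dyadics → Ω → ℝ) (k n : ℕ) (ω : Ω) : ℝ≥0∞ :=
  ⨆ r ∈ Set.Icc (dyad k n) (dyad (k + 2) n), ENNReal.ofReal |B r ω - B (dyad k n) ω|

/-- `M_n`: the supremum of `M_{k,n}` over `k ≤ (n + 1) 2 ^ n`. -/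
noncomputable def maxOsc (B : dyadics → Ω → ℝ) (n : ℕ) (ω : Ω) : ℝ≥0∞ :=
  ⨆ k ∈ Set.Iic ((n + 1) * 2 ^ n), localOsc B k n ω

/-- The event `N = {M_n > 1 / n infinitely often}`. -/
def oscEvent (B : dyadics → Ω → ℝ) : Set Ω :=
  {ω | ∃ᶠ n : ℕ in atTop, (n : ℝ≥0∞)⁻¹ < maxOsc B n ω}

/-- `D ∋ r ↓ t`, that is, `r → t` with `r ∈ D` and `r > t`. -/
def dyadicRight (t : ℝ≥0) : Filter dyadics := comap (fun r : dyadics => (r : ℝ≥0)) (𝓝[>] t)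

/-- `B̃(t, ω) = lim_{D ∋ r ↓ t} B(r, ω)` (an unspecified real number where there is no limit). -/
noncomputable def limitExtension (B : dyadics → Ω → ℝ) (t : ℝ≥0) (ω : Ω) : ℝ :=
  limUnder (dyadicRight t) (fun r => B r ω)

end Paths

/-! Everything rests on one characterization: `B` is Brownian on `D` exactly when it is a centered
Gaussian process with covariance `min r s` (`isDyadicBrownian_of_covariance`, `covariance_eq_min`).
For (A), each value of the midpoint process is a finite linear combination of the `X r`, so only the
covariance has to be computed, by induction on the level (`covariance_levelValue`). For (B), the
fourth moment of a level-`m` increment is of order `4⁻ᵐ`. Markov's inequality and a union bound over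
about `m 2ᵐ` increments show that the probability that some increment exceeds `(9/10)ᵐ` is summable.
By Borel–Cantelli, almost surely all increments are eventually below that size, and chaining them
across levels bounds `M_n` by `12 (9/10)ⁿ`, which is eventually below `1/n`. Off `N` this yields a
modulus of continuity on `D` (`exists_modulus`), hence the continuous extension. Its law is found by
passing to the limit in characteristic functions along dyadic sequences. -/

/-! ### Linear spans of Gaussian families -/

section GaussianSpan

variable {Ω ι : Type*} [MeasurableSpace Ω] {P : Measure Ω} {X : ι → Ω → ℝ}

theorem ProbabilityTheory.iIndepFun.isGaussianProcess (hX : iIndepFun X P)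
    (hlaw : ∀ i, HasGaussianLaw (X i) P) : IsGaussianProcess X P where
  hasGaussianLaw I := (hX.precomp (g := fun i : I => (i : ι)) Subtype.val_injective).hasGaussianLaw
    fun i => hlaw i

theorem ProbabilityTheory.IsGaussianProcess.of_mem_span {κ : Type*} {Y : κ → Ω → ℝ} (hX : IsGaussianProcess X P)
    (hY : ∀ j, Y j ∈ Submodule.span ℝ (Set.range X)) : IsGaussianProcess Y P := by
  refine hX.of_isGaussianProcess fun j => ?_
  obtain ⟨c, hc⟩ := Finsupp.mem_span_range_iff_exists_finsupp.1 (hY j)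
  refine ⟨c.support, ∑ i : c.support, c i • ContinuousLinearMap.proj (R := ℝ) i, fun ω => ?_⟩
  rw [← hc, Finsupp.sum, ← Finset.sum_coe_sort]
  simp [Finset.sum_apply]

theorem ProbabilityTheory.IsGaussianProcess.memLp_of_mem_span {Y : Ω → ℝ} (hX : IsGaussianProcess X P)
    (hY : Y ∈ Submodule.span ℝ (Set.range X)) : MemLp Y 2 P :=
  ((hX.of_mem_span (Y := fun _ : Unit => Y)
    fun _ => hY).hasGaussianLaw_eval ()).memLp_two

theorem integral_eq_zero_of_mem_span {Y : Ω → ℝ} (hX : IsGaussianProcess X P)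
    (h0 : ∀ i, P[X i] = 0) (hY : Y ∈ Submodule.span ℝ (Set.range X)) : P[Y] = 0 := by
  have := hX.isProbabilityMeasure
  induction hY using Submodule.span_induction with
  | mem x hx => obtain ⟨i, rfl⟩ := hx; exact h0 i
  | zero => simp
  | add x y hx hy ihx ihy =>
    have e := integral_add ((hX.memLp_of_mem_span hx).integrable one_le_two)
      ((hX.memLp_of_mem_span hy).integrable one_le_two)
    simp only [Pi.add_apply]
    rw [e, ihx, ihy, add_zero]
  | smul a x hx ih => simp only [Pi.smul_apply, smul_eq_mul, integral_const_mul, ih, mul_zero]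

/-- Used with `S` the indices of level `n` and `i` a new midpoint of level `n + 1`. -/
theorem covariance_eq_zero_of_mem_span {Y : Ω → ℝ} {S : Set ι} {i : ι}
    (hX : IsGaussianProcess X P) (hc : ∀ j ∈ S, cov[X j, X i; P] = 0)
    (hY : Y ∈ Submodule.span ℝ (X '' S)) : cov[Y, X i; P] = 0 := by
  have := hX.isProbabilityMeasure
  have hsub : Submodule.span ℝ (X '' S) ≤ Submodule.span ℝ (Set.range X) :=
    Submodule.span_mono (Set.image_subset_range _ _)
  induction hY using Submodule.span_induction with
  | mem x hx => obtain ⟨j, hj, rfl⟩ := hx; exact hc j hj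
  | zero => simp [covariance]
  | add x y hx hy ihx ihy =>
    rw [covariance_add_left (hX.memLp_of_mem_span (hsub hx)) (hX.memLp_of_mem_span (hsub hy))
      (hX.hasGaussianLaw_eval i).memLp_two, ihx, ihy, add_zero]
  | smul a x hx ih => rw [covariance_smul_left, ih, mul_zero]

end GaussianSpan

/-! ### Covariance of the midpoint construction -/

section Midpoint

variable {Ω : Type*}

theorem dyad_eq_iff {k n l m : ℕ} : dyad k n = dyad l m ↔ k * 2 ^ m = l * 2 ^ n := by
  rw [Subtype.ext_iff]
  change (k : ℝ≥0) / 2 ^ n = (l : ℝ≥0) / 2 ^ m ↔ _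
  rw [div_eq_div_iff (by positivity) (by positivity)]
  norm_cast

theorem exists_eq_dyad (r : dyadics) : ∃ k n, r = dyad k n := by
  obtain ⟨k, n, h⟩ := r.2
  exact ⟨k, n, Subtype.ext h⟩

theorem dyad_eq_dyad_add (k n i : ℕ) : dyad k n = dyad (k * 2 ^ i) (n + i) := by
  rw [dyad_eq_iff]; ring

/-- Keeping track of the level of the indices matters: it makes the variables added at level `n + 1`
uncorrelated with all values of level `n`. -/
theorem levelValue_mem_span (X : dyadics → Ω → ℝ) (n k : ℕ) :
    levelValue X n k ∈ Submodule.span ℝ (X '' Set.range fun j => dyad j n) := by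
  induction n generalizing k with
  | zero =>
    have : levelValue X 0 k = ∑ j ∈ Finset.range k, X (dyad (j + 1) 0) := by
      ext ω; simp [levelValue]
    rw [this]
    exact Submodule.sum_mem _ fun j _ => Submodule.subset_span ⟨_, ⟨j + 1, rfl⟩, rfl⟩
  | succ n ih =>
    have hle : Submodule.span ℝ (X '' Set.range fun j => dyad j n)
        ≤ Submodule.span ℝ (X '' Set.range fun j => dyad j (n + 1)) := by
      refine Submodule.span_mono (Set.image_mono ?_)
      rintro _ ⟨j, rfl⟩
      exact ⟨j * 2 ^ 1, (dyad_eq_dyad_add j n 1).symm⟩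
    by_cases hk : Even k
    · have : levelValue X (n + 1) k = levelValue X n (k / 2) := by
        ext ω; simp [levelValue, hk]
      rw [this]
      exact hle (ih _)
    · have : levelValue X (n + 1) k
          = (2⁻¹ : ℝ) • (levelValue X n (k / 2) + levelValue X n (k / 2 + 1))
            + (√(2 ^ (n + 2)))⁻¹ • X (dyad k (n + 1)) := by
        ext ω
        simp only [levelValue, hk, if_false, Pi.add_apply, Pi.smul_apply, smul_eq_mul]
        ring
      rw [this]
      exact Submodule.add_mem _ (Submodule.smul_mem _ _ (Submodule.add_mem _ (hle (ih _))
        (hle (ih _)))) (Submodule.smul_mem _ _ (Submodule.subset_span ⟨_, ⟨k, rfl⟩, rfl⟩))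

theorem levelValue_succ_odd (X : dyadics → Ω → ℝ) (n a : ℕ) :
    levelValue X (n + 1) (2 * a + 1)
      = (2⁻¹ : ℝ) • (levelValue X n a + levelValue X n (a + 1))
        + (√(2 ^ (n + 2)))⁻¹ • X (dyad (2 * a + 1) (n + 1)) := by
  ext ω
  have h : (2 * a + 1) / 2 = a := by omega
  have h2 : ¬ Even (2 * a + 1) := by simp
  simp only [levelValue, h2, h, if_false, Pi.add_apply, Pi.smul_apply, smul_eq_mul]
  ring

variable [MeasurableSpace Ω] {P : Measure Ω} {X : dyadics → Ω → ℝ}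

/-- Off the diagonal, `min` is affine in each variable between neighbouring points of level `n`, so
averaging reproduces it. At a common midpoint the averages give only `(4a + 1) / 2 ^ (n + 2)`
instead of `(4a + 2) / 2 ^ (n + 2)`; the variance of the new term fills the gap. -/
theorem covariance_levelValue (hX : IsGaussianProcess X P)
    (hv : ∀ r, cov[X r, X r; P] = 1) (hc : ∀ r s, r ≠ s → cov[X r, X s; P] = 0) (n k l : ℕ) :
    cov[levelValue X n k, levelValue X n l; P] = (min k l : ℕ) / 2 ^ n := by
  have := hX.isProbabilityMeasure
  have hL : ∀ n k, MemLp (levelValue X n k) 2 P := fun n k => hX.memLp_of_mem_span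
    (Submodule.span_mono (Set.image_subset_range _ _) (levelValue_mem_span X n k))
  have hLX : ∀ r, MemLp (X r) 2 P := fun r => (hX.hasGaussianLaw_eval r).memLp_two
  induction n generalizing k l with
  | zero =>
    have e : ∀ k, levelValue X 0 k = ∑ j ∈ Finset.range k, X (dyad (j + 1) 0) := by
      intro k; ext ω; simp [levelValue]
    rw [e, e, covariance_sum_sum' (fun _ _ => hLX _) (fun _ _ => hLX _)]
    have : ∀ i j, cov[X (dyad (i + 1) 0), X (dyad (j + 1) 0); P] = if i = j then 1 else 0 := by
      intro i j
      split_ifs with h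
      · rw [h, hv]
      · refine hc _ _ fun h' => h ?_
        simpa using dyad_eq_iff.1 h'
    simp only [this, Finset.sum_ite_eq, Finset.mem_range]
    rw [← Finset.sum_filter, Finset.sum_const, nsmul_one]
    have : Finset.filter (fun i => i < l) (Finset.range k) = Finset.range (min k l) := by
      ext; simp
    simp [this]
  | succ n ih =>
    -- Points of level `n` have even numerators at level `n + 1`, so they differ from every new
    -- midpoint.
    have hzero : ∀ k a, cov[levelValue X n k, X (dyad (2 * a + 1) (n + 1)); P] = 0 := by
      intro k a
      refine covariance_eq_zero_of_mem_span hX ?_ (levelValue_mem_span X n k)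
      rintro _ ⟨j, rfl⟩
      refine hc _ _ fun h => ?_
      rw [dyad_eq_iff, pow_succ] at h
      have : j * 2 = 2 * a + 1 :=
        Nat.eq_of_mul_eq_mul_right (pow_pos two_pos n) (by rw [← h]; ring)
      omega
    have hmix : ∀ a b, cov[levelValue X n a, levelValue X (n + 1) (2 * b + 1); P]
        = 2⁻¹ * (((min a b : ℕ) : ℝ) / 2 ^ n + ((min a (b + 1) : ℕ) : ℝ) / 2 ^ n) := by
      intro a b
      rw [levelValue_succ_odd, covariance_add_right (hL _ _) (((hL _ _).add (hL _ _)).const_smul _)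
        ((hLX _).const_smul _), covariance_smul_right, covariance_smul_right, hzero,
        covariance_add_right (hL _ _) (hL _ _) (hL _ _), ih, ih]
      ring
    obtain ⟨a, rfl | rfl⟩ := Nat.even_or_odd' k <;> obtain ⟨b, rfl | rfl⟩ := Nat.even_or_odd' l
    · rw [levelValue_double, levelValue_double, ih, Nat.mul_min_mul_left, pow_succ]
      push_cast
      field_simp
    · rw [levelValue_double, hmix]
      rcases le_or_gt a b with h | h
      · rw [min_eq_left h, min_eq_left (by omega), min_eq_left (by omega), pow_succ]
        push_cast; field_simp; ring
      · rw [min_eq_right h.le, min_eq_right (by omega), min_eq_right (by omega), pow_succ]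
        push_cast; field_simp; ring
    · rw [levelValue_double, covariance_comm, hmix]
      rcases le_or_gt b a with h | h
      · rw [min_eq_left h, min_eq_left (by omega), min_eq_right (by omega), pow_succ]
        push_cast; field_simp; ring
      · rw [min_eq_right h.le, min_eq_right (by omega), min_eq_left (by omega), pow_succ]
        push_cast; field_simp; ring
    · have hx : cov[X (dyad (2 * a + 1) (n + 1)), levelValue X (n + 1) (2 * b + 1); P]
          = if a = b then (√(2 ^ (n + 2)))⁻¹ else 0 := by
        rw [levelValue_succ_odd, covariance_add_right (hLX _)
          (((hL _ _).add (hL _ _)).const_smul _) ((hLX _).const_smul _), covariance_smul_right,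
          covariance_smul_right, covariance_add_right (hLX _) (hL _ _) (hL _ _),
          covariance_comm, hzero, covariance_comm, hzero]
        split_ifs with h
        · rw [h, hv]; simp
        · rw [hc]
          · simp
          · intro h'
            rw [dyad_eq_iff] at h'
            have := Nat.eq_of_mul_eq_mul_right (pow_pos two_pos (n + 1)) h'
            omega
      have hs : (√(2 ^ (n + 2) : ℝ))⁻¹ * (√(2 ^ (n + 2)))⁻¹ = (2 ^ (n + 2))⁻¹ := by
        rw [← mul_inv, Real.mul_self_sqrt (by positivity)]
      rw [levelValue_succ_odd X n a, covariance_add_left (((hL _ _).add (hL _ _)).const_smul _)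
        ((hLX _).const_smul _) (hL _ _), covariance_smul_left, covariance_smul_left,
        covariance_add_left (hL _ _) (hL _ _) (hL _ _), hmix, hmix, hx]
      rcases lt_trichotomy a b with h | h | h
      · rw [if_neg h.ne, min_eq_left h.le, min_eq_left (by omega), min_eq_left (by omega),
          min_eq_left (by omega), min_eq_left (by omega), pow_succ]
        push_cast; field_simp; ring
      · subst h
        rw [if_pos rfl, hs, min_self, min_self, min_self, min_eq_left (by omega),
          min_eq_right (by omega), pow_succ, pow_succ]
        push_cast; field_simp; ring
      · rw [if_neg h.ne', min_eq_right h.le, min_eq_right (by omega), min_eq_right (by omega),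
          min_eq_right (by omega), min_eq_right (by omega), pow_succ]
        push_cast; field_simp; ring

end Midpoint

/-! ### Brownian motion on the dyadics as a Gaussian process -/

section Characterization

variable {Ω : Type*} [MeasurableSpace Ω] {P : Measure Ω}

theorem hasLaw_gaussianReal_of_variance {Y : Ω → ℝ} (hY : HasGaussianLaw Y P) (h0 : P[Y] = 0)
    {v : ℝ≥0} (hv : Var[Y; P] = v) : HasLaw Y (gaussianReal 0 v) P where
  aemeasurable := hY.aemeasurable
  map_eq := by rw [hY.map_eq_gaussianReal, h0, hv, Real.toNNReal_coe]

/-- Increments are jointly Gaussian, so it suffices that they are uncorrelated; one-dimensional laws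
are fixed by mean and variance. -/
theorem isDyadicBrownian_of_covariance {B : dyadics → Ω → ℝ} (hB : IsGaussianProcess B P)
    (h0 : ∀ r, P[B r] = 0)
    (hc : ∀ r s : dyadics, cov[B r, B s; P] = (min (r : ℝ≥0) s : ℝ≥0)) :
    IsDyadicBrownian B P := by
  have hP := hB.isProbabilityMeasure
  have hL : ∀ r, MemLp (B r) 2 P := fun r => (hB.hasGaussianLaw_eval r).memLp_two
  have hmarg : ∀ r : dyadics, HasLaw (B r) (gaussianReal 0 (r : ℝ≥0)) P := fun r =>
    hasLaw_gaussianReal_of_variance (hB.hasGaussianLaw_eval r) (h0 r) (by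
      rw [← covariance_self (hL r).aemeasurable, hc, min_self])
  refine ⟨?_, hmarg, fun n t ht => ?_, fun r h s hs => ?_⟩
  · have := hmarg (dyad 0 0)
    have e : ((dyad 0 0 : dyadics) : ℝ≥0) = 0 := by simp [dyad]
    rw [e, gaussianReal_zero_var] at this
    exact this.ae_eq_of_dirac
  · refine hB.hasGaussianLaw_increments.iIndepFun_of_covariance_eq_zero fun i j hij => ?_
    rw [covariance_fun_sub_fun_sub (hL _) (hL _) (hL _) (hL _)]
    simp only [hc]
    wlog h : i < j generalizing i j
    · have := this j i hij.symm (by omega)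
      simp only [min_comm] at this ⊢
      linarith
    have h1 : (t i.succ : ℝ≥0) ≤ t j.succ := ht (Fin.strictMono_succ h).le
    have h2 : (t i.succ : ℝ≥0) ≤ t j.castSucc := ht (Fin.le_castSucc_iff.2 (Fin.strictMono_succ h))
    have h3 : (t i.castSucc : ℝ≥0) ≤ t i.succ := ht (Fin.castSucc_le_succ i)
    rw [min_eq_left h1, min_eq_left h2, min_eq_left (h3.trans h1), min_eq_left (h3.trans h2)]
    ring
  · have hrs : (r : ℝ≥0) ≤ s := by rw [hs]; exact le_self_add
    have hint := fun r => (hL r).integrable one_le_two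
    have hlaw : HasLaw (fun ω => B s ω - B r ω) (gaussianReal 0 (h : ℝ≥0)) P :=
      hasLaw_gaussianReal_of_variance hB.hasGaussianLaw_fun_sub
        (by rw [integral_sub (hint s) (hint r), h0, h0, sub_zero]) (by
          rw [← covariance_self (X := fun ω => B s ω - B r ω) ((hL s).sub (hL r)).aemeasurable,
            covariance_fun_sub_fun_sub (hL _) (hL _) (hL _) (hL _), hc, hc, hc, hc, min_self,
            min_self, min_eq_right hrs, min_eq_left hrs, hs]
          push_cast; ring)
    exact ⟨hlaw.aemeasurable, (hmarg h).aemeasurable, by rw [hlaw.map_eq, (hmarg h).map_eq]⟩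

theorem isDyadicBrownian_midpointProcess {X : dyadics → Ω → ℝ} (hX : iIndepFun X P)
    (hlaw : ∀ r, HasLaw (X r) (gaussianReal 0 1) P) : IsDyadicBrownian (midpointProcess X) P := by
  have hG : IsGaussianProcess X P := hX.isGaussianProcess fun r => (hlaw r).hasGaussianLaw
  have hP := hG.isProbabilityMeasure
  have h0 : ∀ r, P[X r] = 0 := fun r => by
    rw [(hlaw r).integral_eq, integral_id_gaussianReal]
  have hv : ∀ r, cov[X r, X r; P] = 1 := fun r => by
    rw [covariance_self (hlaw r).aemeasurable, (hlaw r).variance_eq, variance_id_gaussianReal]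
    simp
  have hc : ∀ r s, r ≠ s → cov[X r, X s; P] = 0 := fun r s hrs =>
    (hX.indepFun hrs).covariance_eq_zero (hlaw r).hasGaussianLaw.memLp_two
      (hlaw s).hasGaussianLaw.memLp_two
  have hspan : ∀ r, midpointProcess X r ∈ Submodule.span ℝ (Set.range X) := fun r => by
    obtain ⟨k, n, rfl⟩ := exists_eq_dyad r
    rw [midpointProcess_dyad]
    exact Submodule.span_mono (Set.image_subset_range _ _) (levelValue_mem_span X n k)
  refine isDyadicBrownian_of_covariance (hG.of_mem_span hspan)
    (fun r => integral_eq_zero_of_mem_span hG h0 (hspan r)) fun r s => ?_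
  obtain ⟨k, n, rfl⟩ := exists_eq_dyad r
  obtain ⟨l, m, rfl⟩ := exists_eq_dyad s
  rw [dyad_eq_dyad_add k n m, dyad_eq_dyad_add l m n, add_comm m n, midpointProcess_dyad,
    midpointProcess_dyad, covariance_levelValue hG hv hc]
  simp only [dyad]
  push_cast
  exact (min_div_div_right (by positivity) _ _).symm

/-- The least dyadic number is zero. -/
noncomputable instance : OrderBot dyadics where
  bot := dyad 0 0
  bot_le r := by
    change ((0 : ℕ) : ℝ≥0) / 2 ^ 0 ≤ (r : ℝ≥0)
    simp

namespace IsDyadicBrownian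

variable {B : dyadics → Ω → ℝ}

theorem isGaussianProcess (hB : IsDyadicBrownian B P) : IsGaussianProcess B P :=
  hB.indep.isGaussianProcess (fun r => (hB.marginal r).hasGaussianLaw) hB.initial

theorem integral_eq_zero (hB : IsDyadicBrownian B P) (r : dyadics) : P[B r] = 0 := by
  rw [(hB.marginal r).integral_eq, integral_id_gaussianReal]

theorem covariance_eq_min (hB : IsDyadicBrownian B P) (r s : dyadics) :
    cov[B r, B s; P] = (min (r : ℝ≥0) s : ℝ≥0) := by
  have hP := hB.isGaussianProcess.isProbabilityMeasure
  have hL : ∀ r, MemLp (B r) 2 P := fun r => (hB.marginal r).hasGaussianLaw.memLp_two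
  wlog h : r ≤ s generalizing r s
  · rw [covariance_comm, this s r (le_of_not_ge h), min_comm]
  have h1 := hB.indep.indepFun_eval_sub bot_le h hB.initial
  have h2 : B s = B s - B r + B r := by simp
  rw [h2, covariance_add_right (hL r) ((hL s).sub (hL r)) (hL r),
    h1.covariance_eq_zero (hL r) ((hL s).sub (hL r)), covariance_self (hL r).aemeasurable,
    (hB.marginal r).variance_eq, variance_id_gaussianReal, zero_add,
    min_eq_left (show (r : ℝ≥0) ≤ s from h)]

/-- The increment over an interval of length `h` is centered Gaussian with variance `h`. -/
theorem hasLaw_sub (hB : IsDyadicBrownian B P) {r h s : dyadics} (hs : (s : ℝ≥0) = r + h) :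
    HasLaw (fun ω => B s ω - B r ω) (gaussianReal 0 (h : ℝ≥0)) P where
  aemeasurable := (hB.stationary r h s hs).aemeasurable_fst
  map_eq := by rw [(hB.stationary r h s hs).map_eq, (hB.marginal h).map_eq]

end IsDyadicBrownian

end Characterization

/-! ### Fourth moments, chaining and Borel–Cantelli -/

section Oscillation

variable {Ω : Type*}

theorem dyad_le_iff {k n l m : ℕ} : dyad k n ≤ dyad l m ↔ k * 2 ^ m ≤ l * 2 ^ n := by
  rw [← Subtype.coe_le_coe]
  change (k : ℝ≥0) / 2 ^ n ≤ (l : ℝ≥0) / 2 ^ m ↔ _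
  rw [div_le_div_iff₀ (by positivity) (by positivity)]
  norm_cast

theorem coe_dyad (k n : ℕ) : ((dyad k n : dyadics) : ℝ≥0) = k / 2 ^ n := rfl

/-- The chaining bound: small increments at all levels from `n` on control the increments of `b`
from a point of level `n` to all nearby dyadic points. -/
theorem abs_sub_le_of_increments_le (b : dyadics → ℝ) {n k : ℕ} (hk : k ≤ (n + 1) * 2 ^ n)
    (h : ∀ m ≥ n, ∀ j < (m + 3) * 2 ^ m,
      |b (dyad (j + 1) m) - b (dyad j m)| ≤ (9 / 10 : ℝ) ^ m) (i j : ℕ)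
    (hj : k * 2 ^ i ≤ j) (hj' : j ≤ (k + 2) * 2 ^ i) :
    |b (dyad j (n + i)) - b (dyad k n)| ≤ (9 / 10 : ℝ) ^ n * (12 - 10 * (9 / 10) ^ i) := by
  -- At most two steps of level `n` give the initial factor `12 - 10 = 2`. Refining from level `n +
  -- i` adds at most one step of size `(9/10) ^ (n + i + 1)`, while the bound grows by `(9/10) ^ (n
  -- + i)`.
  induction i generalizing j with
  | zero =>
    have h2 : 1 ≤ 2 ^ n := Nat.one_le_two_pow
    have h0 : |b (dyad (k + 1) n) - b (dyad k n)| ≤ (9 / 10 : ℝ) ^ n :=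
      h n le_rfl k (by nlinarith)
    have h1 : |b (dyad (k + 1 + 1) n) - b (dyad (k + 1) n)| ≤ (9 / 10 : ℝ) ^ n :=
      h n le_rfl (k + 1) (by nlinarith)
    have hp : (0 : ℝ) < (9 / 10) ^ n := by positivity
    have : j = k ∨ j = k + 1 ∨ j = k + 1 + 1 := by omega
    rw [abs_le] at h0 h1 ⊢
    rcases this with rfl | rfl | rfl <;> simp only [add_zero, pow_zero] <;>
      constructor <;> linarith
  | succ i ih =>
    have hdouble : ∀ a, dyad (2 * a) (n + (i + 1)) = dyad a (n + i) := fun a => by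
      rw [dyad_eq_iff]; ring
    have hp : (0 : ℝ) < (9 / 10) ^ n := by positivity
    have hq : (0 : ℝ) < (9 / 10) ^ i := by positivity
    have hpq := mul_pos hp hq
    rw [pow_succ, ← mul_assoc] at hj hj'
    obtain ⟨a, rfl | rfl⟩ := Nat.even_or_odd' j
    · rw [hdouble]
      refine (ih a (by omega) (by omega)).trans ?_
      rw [pow_succ]
      nlinarith
    · have h1 := ih a (by omega) (by omega)
      have h2 := h (n + (i + 1)) (by omega) (2 * a) (by
        have : (k + 2) * 2 ^ i * 2 ≤ ((n + 1) * 2 ^ n + 2 * 2 ^ n) * 2 ^ i * 2 := by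
          gcongr
          have : 1 ≤ 2 ^ n := Nat.one_le_two_pow
          omega
        have e : ((n + 1) * 2 ^ n + 2 * 2 ^ n) * 2 ^ i * 2 = (n + 3) * 2 ^ (n + (i + 1)) := by ring
        have : (n + 3) * 2 ^ (n + (i + 1)) ≤ (n + (i + 1) + 3) * 2 ^ (n + (i + 1)) := by
          gcongr; omega
        omega)
      rw [hdouble] at h2
      have h3 := abs_sub_le (b (dyad (2 * a + 1) (n + (i + 1)))) (b (dyad a (n + i))) (b (dyad k n))
      refine (h3.trans (add_le_add h2 h1)).trans ?_
      rw [pow_add, pow_succ]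
      nlinarith

theorem maxOsc_le_of_increments_le (B : dyadics → Ω → ℝ) (ω : Ω) {n : ℕ}
    (h : ∀ m ≥ n, ∀ j < (m + 3) * 2 ^ m,
      |B (dyad (j + 1) m) ω - B (dyad j m) ω| ≤ (9 / 10 : ℝ) ^ m) :
    maxOsc B n ω ≤ ENNReal.ofReal (12 * (9 / 10) ^ n) := by
  refine iSup₂_le fun k hk => iSup₂_le fun r hr => ENNReal.ofReal_le_ofReal ?_
  obtain ⟨l, m, rfl⟩ := exists_eq_dyad r
  have h1 := dyad_le_iff.1 hr.1
  have h2 := dyad_le_iff.1 hr.2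
  rw [dyad_eq_dyad_add l m n, add_comm m n]
  refine (abs_sub_le_of_increments_le (fun r => B r ω) hk h m (l * 2 ^ n) h1 h2).trans ?_
  have hp : (0 : ℝ) < (9 / 10) ^ n := by positivity
  have hq : (0 : ℝ) < (9 / 10) ^ m := by positivity
  nlinarith [mul_pos hp hq]

theorem eventually_ofReal_le_inv :
    ∀ᶠ n : ℕ in atTop, ENNReal.ofReal (12 * (9 / 10) ^ n) ≤ (n : ℝ≥0∞)⁻¹ := by
  have h := tendsto_self_mul_const_pow_of_lt_one (r := (9 / 10 : ℝ)) (by norm_num) (by norm_num)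
  filter_upwards [h.eventually (gt_mem_nhds (show (0 : ℝ) < 1 / 12 by norm_num)),
    eventually_ge_atTop 1] with n hn hn1
  have hn0 : (0 : ℝ) < n := by exact_mod_cast hn1
  rw [← ENNReal.ofReal_natCast, ← ENNReal.ofReal_inv_of_pos hn0]
  refine ENNReal.ofReal_le_ofReal ?_
  rw [← one_div, le_div_iff₀ hn0]
  linarith

variable [MeasurableSpace Ω] {P : Measure Ω}

theorem integral_pow_four_gaussianReal (v : ℝ≥0) :
    ∫ x, x ^ 4 ∂gaussianReal 0 v = v ^ 2 * ∫ x, x ^ 4 ∂gaussianReal 0 1 := by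
  have h : gaussianReal 0 v = (gaussianReal 0 1).map (√(v : ℝ) * ·) := by
    rw [gaussianReal_map_const_mul, mul_zero]
    congr 1
    ext
    simp
  rw [h, integral_map (by fun_prop) (by fun_prop), ← integral_const_mul]
  congr 1 with x
  rw [mul_pow, show √(v : ℝ) ^ 4 = (√(v : ℝ) ^ 2) ^ 2 by ring, Real.sq_sqrt v.coe_nonneg]

/-- Markov's inequality for `Y ^ 4`. Second moments would not do: the factor `2⁻ᵐ` they give is
cancelled by the number of increments at level `m`. -/
theorem measure_abs_gt_le_of_hasLaw_gaussianReal {Y : Ω → ℝ} {v : ℝ≥0}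
    (hY : HasLaw Y (gaussianReal 0 v) P) {ε : ℝ} (hε : 0 < ε) :
    P {ω | ε < |Y ω|}
      ≤ ENNReal.ofReal ((v : ℝ) ^ 2 * (∫ x, x ^ 4 ∂gaussianReal 0 1) / ε ^ 4) := by
  have hP : IsProbabilityMeasure P := hY.isProbabilityMeasure
  have hint : Integrable (fun x : ℝ => x ^ 4) (gaussianReal 0 v) := by
    have := (memLp_id_gaussianReal (μ := 0) (v := v) 4).integrable_norm_pow (p := 4) (by norm_num)
    refine this.congr (Eventually.of_forall fun x => ?_)
    simp [Even.pow_abs (show Even 4 by decide)]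
  have hint' : Integrable (fun ω => Y ω ^ 4) P := by
    rw [← hY.map_eq] at hint
    exact hint.comp_aemeasurable hY.aemeasurable
  have h1 := mul_meas_ge_le_integral_of_nonneg (μ := P) (f := fun ω => Y ω ^ 4)
    (Eventually.of_forall fun ω => by positivity) hint' (ε ^ 4)
  have h2 : ∫ ω, Y ω ^ 4 ∂P = ∫ x, x ^ 4 ∂gaussianReal 0 v := by
    rw [← hY.map_eq, integral_map hY.aemeasurable (by fun_prop)]
  rw [h2, integral_pow_four_gaussianReal] at h1
  have h3 : P {ω | ε < |Y ω|} ≤ P {ω | ε ^ 4 ≤ Y ω ^ 4} := by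
    refine measure_mono fun ω (hω : ε < |Y ω|) => ?_
    change ε ^ 4 ≤ Y ω ^ 4
    rw [← Even.pow_abs (show Even 4 by decide) (Y ω)]
    gcongr
  refine h3.trans ?_
  rw [← ofReal_measureReal]
  refine ENNReal.ofReal_le_ofReal ?_
  rw [le_div_iff₀ (by positivity), mul_comm]
  exact h1

theorem IsDyadicBrownian.measure_oscEvent {B : dyadics → Ω → ℝ} (hB : IsDyadicBrownian B P) :
    P (oscEvent B) = 0 := by
  have hP := hB.isGaussianProcess.isProbabilityMeasure
  set C : ℝ := ∫ x, x ^ 4 ∂gaussianReal 0 1 with hC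
  -- The range reaches time `m + 3`, since the intervals in `M_n` end at `(k + 2) / 2 ^ n` with `k ≤
  -- (n + 1) 2 ^ n`.
  let A : ℕ → Set Ω := fun m => ⋃ j ∈ Finset.range ((m + 3) * 2 ^ m),
    {ω | (9 / 10 : ℝ) ^ m < |B (dyad (j + 1) m) ω - B (dyad j m) ω|}
  -- The ratio is `2 * (1/2) ^ 2 / (9/10) ^ 4`; any threshold base in `(2 ^ (-1/4), 1)` could
  -- replace `9/10` in making it less than one.
  have hA : ∀ m, P (A m) ≤ ENNReal.ofReal (C * ((m + 3) * (5000 / 6561) ^ m)) := fun m => by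
    have h1 : ∀ j, P {ω | (9 / 10 : ℝ) ^ m < |B (dyad (j + 1) m) ω - B (dyad j m) ω|}
        ≤ ENNReal.ofReal (C * (2500 / 6561) ^ m) := fun j => by
      have hlaw := hB.hasLaw_sub (r := dyad j m) (h := dyad 1 m) (s := dyad (j + 1) m) (by
        simp only [coe_dyad]; push_cast; ring)
      refine (measure_abs_gt_le_of_hasLaw_gaussianReal hlaw (by positivity)).trans_eq ?_
      congr 1
      rw [coe_dyad, ← hC]
      push_cast
      have e : (2500 / 6561 : ℝ) ^ m = (1 / 2 ^ m) ^ 2 / ((9 / 10) ^ m) ^ 4 := by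
        rw [show (2500 / 6561 : ℝ) = (1 / 2) ^ 2 / (9 / 10) ^ 4 by norm_num, div_pow,
          pow_right_comm, pow_right_comm (9 / 10 : ℝ), one_div_pow]
      rw [e]
      ring
    calc P (A m) ≤ ∑ j ∈ Finset.range ((m + 3) * 2 ^ m), _ := measure_biUnion_finset_le _ _
      _ ≤ ∑ j ∈ Finset.range ((m + 3) * 2 ^ m), ENNReal.ofReal (C * (2500 / 6561) ^ m) :=
        Finset.sum_le_sum fun j _ => h1 j
      _ = _ := by
        rw [Finset.sum_const, Finset.card_range, nsmul_eq_mul, ← ENNReal.ofReal_natCast,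
          ← ENNReal.ofReal_mul (by positivity)]
        congr 1
        push_cast
        rw [show (5000 / 6561 : ℝ) = 2 * (2500 / 6561) by norm_num, mul_pow]
        ring
  have hsum : Summable fun m : ℕ => C * ((m + 3 : ℝ) * (5000 / 6561) ^ m) := by
    have h1 := summable_pow_mul_geometric_of_norm_lt_one (r := (5000 / 6561 : ℝ)) 1
      (by rw [Real.norm_eq_abs, abs_of_pos] <;> norm_num)
    have h0 := summable_geometric_of_norm_lt_one (x := (5000 / 6561 : ℝ))
      (by rw [Real.norm_eq_abs, abs_of_pos] <;> norm_num)
    refine ((h1.add (h0.mul_left 3)).mul_left C).congr fun m => ?_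
    ring
  have htop : ∑' m, P (A m) ≠ ∞ :=
    ne_top_of_le_ne_top hsum.tsum_ofReal_ne_top (ENNReal.tsum_le_tsum hA)
  refine measure_mono_null ?_ (ae_iff.1 (ae_eventually_notMem htop))
  intro ω hω hev
  refine hω ?_
  obtain ⟨n₀, hn₀⟩ := eventually_atTop.1 hev
  filter_upwards [eventually_ofReal_le_inv, eventually_ge_atTop n₀] with n hn hn'
  rw [not_lt]
  refine (maxOsc_le_of_increments_le B ω fun m hm j hj => ?_).trans hn
  have := hn₀ m (hn'.trans hm)
  simp only [A, Set.mem_iUnion, Finset.mem_range, not_exists, Set.mem_ofPred_eq, not_lt] at this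
  exact this j hj

end Oscillation

/-! ### Path regularity off the exceptional event -/

section PathRegularity

variable {Ω : Type*} {B : dyadics → Ω → ℝ} {ω : Ω}

/-- With `k = ⌊r 2ⁿ⌋`, both `r` and `s` lie in the interval of `M_{k,n}`; this is why it has two
mesh lengths. Comparing both with its left end costs `1/n` twice. -/
theorem abs_sub_le_of_maxOsc_le {n : ℕ} (hn : 1 ≤ n) (h : maxOsc B n ω ≤ (n : ℝ≥0∞)⁻¹)
    {r s : dyadics} (hr : (r : ℝ≥0) ≤ n + 1) (hrs : r ≤ s) (hs : (s : ℝ≥0) ≤ r + 1 / 2 ^ n) :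
    |B s ω - B r ω| ≤ 2 / n := by
  have hn0 : (0 : ℝ) < n := by exact_mod_cast hn
  have hp : (0 : ℝ≥0) < 2 ^ n := by positivity
  set k := ⌊(r : ℝ≥0) * 2 ^ n⌋₊
  have hk1 : (k : ℝ≥0) ≤ r * 2 ^ n := Nat.floor_le zero_le
  have hk2 : (r : ℝ≥0) * 2 ^ n < k + 1 := Nat.lt_floor_add_one _
  have hk : k ≤ (n + 1) * 2 ^ n := by
    have : (k : ℝ≥0) ≤ (n + 1) * 2 ^ n := hk1.trans (by gcongr)
    exact_mod_cast this
  have hkr : dyad k n ≤ r := (div_le_iff₀ hp).2 hk1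
  have hsk : s ≤ dyad (k + 2) n := by
    refine (le_div_iff₀ hp).2 ?_
    calc (s : ℝ≥0) * 2 ^ n ≤ (r + 1 / 2 ^ n) * 2 ^ n := by gcongr
      _ = r * 2 ^ n + 1 := by field_simp
      _ ≤ k + 1 + 1 := by gcongr
      _ = ((k + 2 : ℕ) : ℝ≥0) := by push_cast; ring
  have key : ∀ q ∈ Set.Icc (dyad k n) (dyad (k + 2) n), |B q ω - B (dyad k n) ω| ≤ 1 / n := by
    intro q hq
    have h1 : ENNReal.ofReal |B q ω - B (dyad k n) ω| ≤ (n : ℝ≥0∞)⁻¹ := by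
      refine le_trans ?_ h
      refine le_trans ?_ (le_iSup₂ (f := fun k _ => localOsc B k n ω) k hk)
      exact le_iSup₂ (f := fun (r : dyadics) _ => ENNReal.ofReal |B r ω - B (dyad k n) ω|) q hq
    rw [← ENNReal.ofReal_natCast, ← ENNReal.ofReal_inv_of_pos hn0,
      ENNReal.ofReal_le_ofReal_iff (by positivity)] at h1
    rwa [one_div]
  have h1 := key s ⟨hkr.trans hrs, hsk⟩
  have h2 := key r ⟨hkr, hrs.trans hsk⟩
  rw [abs_sub_comm] at h2
  calc |B s ω - B r ω| ≤ _ := abs_sub_le _ (B (dyad k n) ω) _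
    _ ≤ 1 / n + 1 / n := add_le_add h1 h2
    _ = 2 / n := by ring

theorem exists_modulus (hω : ω ∉ oscEvent B) (t : ℝ≥0) {ε : ℝ} (hε : 0 < ε) :
    ∃ δ > 0, ∀ r s : dyadics, (r : ℝ≥0) ≤ t → (s : ℝ≥0) ≤ t →
      dist (r : ℝ≥0) s ≤ δ → dist (B r ω) (B s ω) < ε := by
  have h1 : ∀ᶠ n : ℕ in atTop, maxOsc B n ω ≤ (n : ℝ≥0∞)⁻¹ := by
    simpa only [oscEvent, Set.mem_ofPred_eq, not_frequently, not_lt] using hω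
  have h2 : ∀ᶠ n : ℕ in atTop, 2 / (n : ℝ) < ε :=
    (tendsto_const_div_atTop_nhds_zero_nat 2).eventually (gt_mem_nhds hε)
  obtain ⟨n, hn, hnε, hn1, hnt⟩ := (h1.and (h2.and ((eventually_ge_atTop 1).and
    (eventually_ge_atTop ⌈t⌉₊)))).exists
  have ht : t ≤ n + 1 := (Nat.le_ceil t).trans ((Nat.cast_le.2 hnt).trans le_self_add)
  refine ⟨1 / 2 ^ n, by positivity, fun r s hr hs hd => ?_⟩
  rw [NNReal.dist_eq, abs_le] at hd
  have hle : ∀ r s : dyadics, ((s : ℝ≥0) : ℝ) ≤ (r : ℝ≥0) + 1 / 2 ^ n →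
      (s : ℝ≥0) ≤ r + 1 / 2 ^ n := fun r s h => by
    rw [← NNReal.coe_le_coe]; push_cast; exact h
  rcases le_total r s with hrs | hrs
  · rw [dist_comm]
    exact (abs_sub_le_of_maxOsc_le hn1 hn (hr.trans ht) hrs
      (hle r s (by linarith [hd.1]))).trans_lt hnε
  · exact (abs_sub_le_of_maxOsc_le hn1 hn (hs.trans ht) hrs
      (hle s r (by linarith [hd.2]))).trans_lt hnε

theorem uniformContinuousOn_of_notMem_oscEvent (hω : ω ∉ oscEvent B) (t : ℝ≥0) :
    UniformContinuousOn (fun r => B r ω) {r : dyadics | (r : ℝ≥0) ≤ t} := by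
  rw [Metric.uniformContinuousOn_iff]
  intro ε hε
  obtain ⟨δ, hδ, h⟩ := exists_modulus hω t hε
  exact ⟨δ, hδ, fun r hr s hs hd => h r s hr hs hd.le⟩

theorem exists_dyadic_btwn {s t : ℝ≥0} (h : s < t) : ∃ r : dyadics, s < r ∧ (r : ℝ≥0) < t := by
  obtain ⟨n, hn⟩ := exists_pow_lt_of_lt_one (tsub_pos_of_lt h) (show (2⁻¹ : ℝ≥0) < 1 by
    rw [inv_lt_one₀] <;> norm_num)
  have hp : (0 : ℝ≥0) < 2 ^ n := by positivity
  refine ⟨dyad (⌊s * 2 ^ n⌋₊ + 1) n, ?_, ?_⟩ <;> rw [coe_dyad]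
  · rw [lt_div_iff₀ hp]
    push_cast
    exact Nat.lt_floor_add_one _
  · have h1 : (⌊s * 2 ^ n⌋₊ : ℝ≥0) ≤ s * 2 ^ n := Nat.floor_le zero_le
    calc ((⌊s * 2 ^ n⌋₊ + 1 : ℕ) : ℝ≥0) / 2 ^ n ≤ (s * 2 ^ n + 1) / 2 ^ n := by
          push_cast; gcongr
      _ = s + 2⁻¹ ^ n := by rw [add_div, mul_div_cancel_right₀ _ hp.ne', inv_pow, one_div]
      _ < s + (t - s) := by gcongr
      _ = t := add_tsub_cancel_of_le h.le

instance dyadicRight_neBot (t : ℝ≥0) : (dyadicRight t).NeBot := by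
  refine comap_neBot fun u hu => ?_
  obtain ⟨c, hc, hcu⟩ := (mem_nhdsGT_iff_exists_Ioo_subset).1 hu
  obtain ⟨r, h1, h2⟩ := exists_dyadic_btwn hc
  exact ⟨r, hcu ⟨h1, h2⟩⟩

/-- Provides dyadic sequences decreasing to `t` from the right, so that dominated convergence
applies to the limit. -/
instance dyadicRight_isCountablyGenerated (t : ℝ≥0) : (dyadicRight t).IsCountablyGenerated := by
  unfold dyadicRight; infer_instance

theorem tendsto_coe_dyadicRight (t : ℝ≥0) :
    Tendsto (fun r : dyadics => (r : ℝ≥0)) (dyadicRight t) (𝓝 t) :=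
  tendsto_comap.mono_right nhdsWithin_le_nhds

theorem tendsto_limitExtension (hω : ω ∉ oscEvent B) (t : ℝ≥0) :
    Tendsto (fun r => B r ω) (dyadicRight t) (𝓝 (limitExtension B t ω)) := by
  refine tendsto_nhds_limUnder (CompleteSpace.complete ?_)
  rw [Metric.cauchy_iff]
  refine ⟨inferInstance, fun ε hε => ?_⟩
  -- The approximating points lie to the right of `t`, so the modulus is taken on a larger interval.
  obtain ⟨δ, hδ, h⟩ := exists_modulus hω (t + 1) hε
  have h1 : ∀ᶠ r : dyadics in dyadicRight t, dist (r : ℝ≥0) t < δ / 2 :=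
    (tendsto_coe_dyadicRight t).eventually (Metric.ball_mem_nhds t (half_pos hδ))
  have h2 : ∀ᶠ r : dyadics in dyadicRight t, (r : ℝ≥0) < t + 1 :=
    (tendsto_coe_dyadicRight t).eventually (gt_mem_nhds (lt_add_one t))
  refine ⟨_, image_mem_map (h1.and h2), ?_⟩
  rintro _ ⟨r, ⟨hr1, hr2⟩, rfl⟩ _ ⟨s, ⟨hs1, hs2⟩, rfl⟩
  exact h r s hr2.le hs2.le (by linarith [dist_triangle_right (r : ℝ≥0) s t])

theorem limitExtension_coe (hω : ω ∉ oscEvent B) (r : dyadics) :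
    limitExtension B r ω = B r ω := by
  refine tendsto_nhds_unique (tendsto_limitExtension hω r) ?_
  rw [Metric.tendsto_nhds]
  intro ε hε
  obtain ⟨δ, hδ, h⟩ := exists_modulus hω (r + 1) hε
  filter_upwards [(tendsto_coe_dyadicRight r).eventually (Metric.ball_mem_nhds _ hδ),
    (tendsto_coe_dyadicRight r).eventually (gt_mem_nhds (lt_add_one _))] with s hs1 hs2
  exact h s r hs2.le le_self_add (le_of_lt hs1)

theorem continuous_limitExtension (hω : ω ∉ oscEvent B) :
    Continuous fun t => limitExtension B t ω := by
  rw [Metric.continuous_iff]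
  intro t ε hε
  -- Half of `ε`, because the strict bound weakens to `≤` in the limit; `t + 2` leaves room to the
  -- right of every `s < t + 1`.
  obtain ⟨δ, hδ, h⟩ := exists_modulus hω (t + 2) (half_pos hε)
  refine ⟨min δ 1, by positivity, fun s hs => ?_⟩
  have hs1 : dist s t < δ := hs.trans_le (min_le_left _ _)
  have hs2 : s < t + 2 := by
    have := (abs_lt.1 (hs.trans_le (min_le_right _ _))).2
    change (s : ℝ) - t < 1 at this
    rw [← NNReal.coe_lt_coe]
    push_cast
    linarith
  have hlim := ((tendsto_limitExtension hω s).comp tendsto_fst).dist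
    ((tendsto_limitExtension hω t).comp (tendsto_snd (f := dyadicRight s)))
  refine lt_of_le_of_lt (le_of_tendsto hlim ?_) (half_lt_self hε)
  have hc : Tendsto (fun p : dyadics × dyadics => dist (p.1 : ℝ≥0) p.2)
      (dyadicRight s ×ˢ dyadicRight t) (𝓝 (dist s t)) :=
    ((tendsto_coe_dyadicRight s).comp tendsto_fst).dist
      ((tendsto_coe_dyadicRight t).comp tendsto_snd)
  filter_upwards [hc.eventually (gt_mem_nhds hs1),
    ((tendsto_coe_dyadicRight s).comp tendsto_fst).eventually (gt_mem_nhds hs2),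
    ((tendsto_coe_dyadicRight t).comp tendsto_snd).eventually
      (gt_mem_nhds (lt_add_of_pos_right t two_pos))] with p h1 h2 h3
  exact (h p.1 p.2 h2.le h3.le h1.le).le

end PathRegularity

/-! ### Law of the continuous extension -/

section LimitLaw

variable {Ω : Type*} [MeasurableSpace Ω] {P : Measure Ω}

/-- The characteristic function of a centered Gaussian vector in terms of its covariances. -/
theorem integral_cexp_of_hasGaussianLaw {ι : Type*} [Fintype ι] {Y : ι → Ω → ℝ}
    (hY : HasGaussianLaw (fun ω i => Y i ω) P) (h0 : ∀ i, P[Y i] = 0) (c : ι → ℝ) :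
    ∫ ω, Complex.exp ((∑ i, c i * Y i ω : ℝ) * Complex.I) ∂P
      = Complex.exp (-((∑ i, ∑ j, c i * c j * cov[Y i, Y j; P] : ℝ) : ℂ) / 2) := by
  have hP := hY.isProbabilityMeasure
  have hL : ∀ i, MemLp (Y i) 2 P := fun i => (hY.eval i).memLp_two
  let L : (ι → ℝ) →L[ℝ] ℝ := ∑ i, c i • ContinuousLinearMap.proj (R := ℝ) i
  have hLY : (L ∘ fun ω i => Y i ω) = fun ω => ∑ i, c i * Y i ω := by
    ext ω; simp [L]
  have hG : HasGaussianLaw (fun ω => ∑ i, c i * Y i ω) P := hLY ▸ hY.map L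
  have hmean : ∫ ω, ∑ i, c i * Y i ω ∂P = 0 := by
    rw [integral_finsetSum _ fun i _ => ((hL i).integrable one_le_two).const_mul _]
    simp [integral_const_mul, h0]
  have hvar : Var[fun ω => ∑ i, c i * Y i ω; P]
      = ∑ i, ∑ j, c i * c j * cov[Y i, Y j; P] := by
    rw [variance_fun_sum fun i => (hL i).const_mul (c i)]
    refine Finset.sum_congr rfl fun i _ => Finset.sum_congr rfl fun j _ => ?_
    rw [covariance_const_mul_left, covariance_const_mul_right, mul_assoc]
  have h1 := charFun_gaussianReal (μ := 0) (v := (Var[fun ω => ∑ i, c i * Y i ω; P]).toNNReal) 1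
  have h2 := hG.map_eq_gaussianReal
  rw [hmean] at h2
  rw [← h2, charFun_apply_real, integral_map hG.aemeasurable (by fun_prop)] at h1
  simp only [Complex.ofReal_one, one_mul, Complex.ofReal_zero, mul_zero, zero_mul, zero_sub,
    one_pow, mul_one, Real.coe_toNNReal _ (variance_nonneg _ _)] at h1
  rw [h1, hvar, neg_div]

/-- A process that is the almost sure limit of centered Gaussian vectors whose covariances converge
to those of Brownian motion is a pre-Brownian motion. -/
theorem isPreBrownianReal_of_tendsto [IsProbabilityMeasure P] {W : ℝ≥0 → Ω → ℝ}
    {Y : ℕ → ℝ≥0 → Ω → ℝ} (hY : ∀ n, IsGaussianProcess (Y n) P) (h0 : ∀ n t, P[Y n t] = 0)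
    (hc : ∀ s t, Tendsto (fun n => cov[Y n s, Y n t; P]) atTop (𝓝 (min s t : ℝ≥0)))
    (hlim : ∀ t, ∀ᵐ ω ∂P, Tendsto (fun n => Y n t ω) atTop (𝓝 (W t ω))) :
    IsPreBrownianReal W P where
  hasLaw I := by
    have hW : ∀ t, AEMeasurable (W t) P := fun t =>
      aemeasurable_of_tendsto_metrizable_ae atTop (fun n => (hY n).aemeasurable t) (hlim t)
    have hWI : AEMeasurable (fun ω => I.restrict (W · ω)) P :=
      aemeasurable_pi_lambda _ fun i => hW i
    have := Measure.isProbabilityMeasure_map hWI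
    refine ⟨hWI, Measure.ext_of_charFunDual (funext fun L => ?_)⟩
    classical
    -- Every functional is a linear combination of coordinates, so both characteristic functions
    -- reduce to explicit expressions in `c`.
    let c : I → ℝ := fun i => L (Pi.single i 1)
    have hLc : ∀ x, L x = ∑ i, c i * x i := fun x => by
      conv_lhs => rw [pi_eq_sum_univ' x]
      simp [c, map_sum, mul_comm]
    have hproj : charFunDual (BrownianReal.projectiveFamily I) L
        = Complex.exp (-((∑ i, ∑ j, c i * c j * (min (i : ℝ≥0) j : ℝ≥0) : ℝ) : ℂ) / 2) := by
      have h := integral_cexp_of_hasGaussianLaw (P := BrownianReal.projectiveFamily I)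
        (Y := fun i x => x i) IsGaussian.hasGaussianLaw_id
        (fun i => BrownianReal.integral_eval_projectiveFamily I i) c
      simp only [BrownianReal.covariance_eval_projectiveFamily] at h
      rw [charFunDual_apply, ← h]
      simp only [hLc]
    have hWint : charFunDual (P.map fun ω => I.restrict (W · ω)) L
        = ∫ ω, Complex.exp ((∑ i : I, c i * W i ω : ℝ) * Complex.I) ∂P := by
      rw [charFunDual_apply, integral_map hWI (by fun_prop)]
      simp only [hLc, Finset.restrict]
    rw [hproj, hWint]
    -- The integrands have modulus one, so almost sure convergence suffices.
    have hA : Tendsto (fun n => ∫ ω, Complex.exp ((∑ i : I, c i * Y n i ω : ℝ) * Complex.I) ∂P)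
        atTop (𝓝 (∫ ω, Complex.exp ((∑ i : I, c i * W i ω : ℝ) * Complex.I) ∂P)) := by
      refine tendsto_integral_of_dominated_convergence (fun _ => 1) (fun n => ?_)
        (integrable_const 1) (fun n => Eventually.of_forall fun ω => ?_) ?_
      · have : AEMeasurable (fun ω => ∑ i : I, c i * Y n i ω) P :=
          Finset.aemeasurable_fun_sum _ fun i _ => ((hY n).aemeasurable i).const_mul _
        exact (by fun_prop : Measurable fun x : ℝ =>
          Complex.exp ((x : ℂ) * Complex.I)).comp_aemeasurable this |>.aestronglyMeasurable
      · rw [Complex.norm_exp_ofReal_mul_I]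
      · have : ∀ᵐ ω ∂P, ∀ i : I, Tendsto (fun n => Y n i ω) atTop (𝓝 (W i ω)) :=
          ae_all_iff.2 fun i => hlim i
        filter_upwards [this] with ω hω
        have h1 : Tendsto (fun n => ∑ i : I, c i * Y n i ω) atTop (𝓝 (∑ i : I, c i * W i ω)) :=
          tendsto_finsetSum _ fun i _ => (hω i).const_mul _
        exact ((by fun_prop : Continuous fun x : ℝ =>
          Complex.exp ((x : ℂ) * Complex.I)).tendsto _).comp h1
    have hB : Tendsto (fun n => ∫ ω, Complex.exp ((∑ i : I, c i * Y n i ω : ℝ) * Complex.I) ∂P)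
        atTop (𝓝 (Complex.exp
          (-((∑ i : I, ∑ j : I, c i * c j * (min (i : ℝ≥0) j : ℝ≥0) : ℝ) : ℂ) / 2))) := by
      have h1 : ∀ n, ∫ ω, Complex.exp ((∑ i : I, c i * Y n i ω : ℝ) * Complex.I) ∂P = _ :=
        fun n => integral_cexp_of_hasGaussianLaw (Y := fun i : I => Y n i)
          ((hY n).hasGaussianLaw I) (fun i => h0 n i) c
      simp only [h1]
      have h2 : Tendsto (fun n => ∑ i : I, ∑ j : I, c i * c j * cov[Y n i, Y n j; P]) atTop
          (𝓝 (∑ i : I, ∑ j : I, c i * c j * (min (i : ℝ≥0) j : ℝ≥0))) :=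
        tendsto_finsetSum _ fun i _ => tendsto_finsetSum _ fun j _ => (hc i j).const_mul _
      exact ((by fun_prop : Continuous fun x : ℝ =>
        Complex.exp (-(x : ℂ) / 2)).tendsto _).comp h2
    exact tendsto_nhds_unique hA hB

/-- Along dyadic `dₙ(t) ↓ t` the covariances `min (dₙ(s)) (dₙ(t))` converge to `min s t`. The values
of the extension on `N` play no role, as `N` is null. -/
theorem IsDyadicBrownian.isBrownianReal_limitExtension {B : dyadics → Ω → ℝ}
    (hB : IsDyadicBrownian B P) : IsBrownianReal (limitExtension B) P := by
  have hP := hB.isGaussianProcess.isProbabilityMeasure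
  have hN : ∀ᵐ ω ∂P, ω ∉ oscEvent B := measure_eq_zero_iff_ae_notMem.1 hB.measure_oscEvent
  have hd : ∀ t : ℝ≥0, ∃ d : ℕ → dyadics, Tendsto d atTop (dyadicRight t) := fun t =>
    exists_seq_tendsto _
  choose d hd using hd
  refine ⟨isPreBrownianReal_of_tendsto (Y := fun n t => B (d t n))
    (fun n => hB.isGaussianProcess.comp_right fun t => d t n)
    (fun n t => hB.integral_eq_zero _) (fun s t => ?_) fun t => ?_, ?_⟩
  · simp only [hB.covariance_eq_min]
    exact (NNReal.continuous_coe.tendsto _).comp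
      (((tendsto_coe_dyadicRight s).comp (hd s)).min ((tendsto_coe_dyadicRight t).comp (hd t)))
  · filter_upwards [hN] with ω hω
    exact (tendsto_limitExtension hω t).comp (hd t)
  · filter_upwards [hN] with ω hω
    exact continuous_limitExtension hω

end LimitLaw

theorem mainTheorem2 {Ω : Type*} [MeasurableSpace Ω] (P : Measure Ω) [IsProbabilityMeasure P] :
    -- the process built from independent standard normal variables is Brownian on `D`
    (∀ X : dyadics → Ω → ℝ, iIndepFun X P → (∀ r, HasLaw (X r) (gaussianReal 0 1) P) →
      IsDyadicBrownian (midpointProcess X) P) ∧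
    -- every Brownian motion on `D` extends to a standard Brownian motion
    (∀ B : dyadics → Ω → ℝ, IsDyadicBrownian B P →
      P (oscEvent B) = 0 ∧
      (∀ ω ∉ oscEvent B,
        (∀ t : ℝ≥0, UniformContinuousOn (fun r => B r ω) {r : dyadics | (r : ℝ≥0) ≤ t}) ∧
        (∀ t : ℝ≥0, Tendsto (fun r => B r ω) (dyadicRight t) (𝓝 (limitExtension B t ω))) ∧
        (∀ r : dyadics, limitExtension B r ω = B r ω) ∧
        Continuous (fun t => limitExtension B t ω)) ∧
      (∀ I : Finset dyadics,
        P.map (fun ω (r : I) => limitExtension B (r : dyadics) ω)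
          = P.map (fun ω (r : I) => B r ω)) ∧
      IsBrownianReal (limitExtension B) P) := by
  refine ⟨fun X hX hlaw => isDyadicBrownian_midpointProcess hX hlaw, fun B hB =>
    ⟨hB.measure_oscEvent, fun ω hω => ⟨uniformContinuousOn_of_notMem_oscEvent hω,
      tendsto_limitExtension hω, limitExtension_coe hω, continuous_limitExtension hω⟩,
      fun I => Measure.map_congr ?_, hB.isBrownianReal_limitExtension⟩⟩
  filter_upwards [measure_eq_zero_iff_ae_notMem.1 hB.measure_oscEvent] with ω hω
  exact funext fun r => limitExtension_coe hω r
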